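/- Let $k$ be an algebraically closed field of characteristic $0$ and let $n\ge 2$. For $A,B\subseteq k$ write $A\equiv_p B$ if there are polynomials $P,Q\in k[X]$ with $A=P^{-1}(B)$ and $B=Q^{-1}(A)$, and let $[B]=\{A\subseteq k\mid A\equiv_p B\}$ be the polynomial class of $B$. Let $f_n=\prod_{j\ne j'}(X_j-X_{j'})\in k[X_1,\ldots,X_n]$, and let $D(f_n)\subseteq k^n$ be the set of points with pairwise distinct coordinates, with the topology induced by the Zariski topology and with regular functions the quotients $g/f_n^r$, where $g\in k[X_1,\ldots,X_n]$ and $r\in\mathbb N$. Let $\mathcal P_n$ be the set of $n$-element subsets of $k$, regarded as the quotient of $D(f_n)$ under $\theta:(a_1,\ldots,a_n)\mapsto\{a_1,\ldots,a_n\}$; let $\Sigma_n$ be the quotient of $\mathcal P_n$ by $\equiv_p$, with projection $\theta'$. Both carry the quotient topology, and a $k$-valued function on $\mathcal P_n$ (resp. $\Sigma_n$) is regular if its composition with $\theta$ (resp. with $\theta'$) is regular on $D(f_n)$ (resp. on $\mathcal P_n$). An affine variety is a space with a ring of $k$-valued functions that is isomorphic to a Zariski closed subset of some $k^m$ with its polynomial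 functions; dimension means Krull dimension of the topological space. Then $\mathcal P_n$ is an affine variety, $\Sigma_n$ is an irreducible affine variety, and: 1. for every $B\in\mathcal P_n$, the polynomial class $[B]$ is contained in $\mathcal P_n$ and is a closed irreducible subset of $\mathcal P_n$ of dimension $2$; 2. $\dim(\Sigma_n)=n-2$. -/

import Mathlib

namespace PolyClass

/-! ### Polynomial reducibility -/

/-- `A ≤ₚ B`: there is a polynomial function `P : k → k` with `A = P⁻¹(B)`. -/
def PolyReducible {k : Type*} [Field k] (A B : Set k) : Prop :=
  ∃ P : Polynomial k, A = (fun x => P.eval x) ⁻¹' B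

/-- Polynomial bireducibility `A ≡ₚ B`. -/
def PolyEquiv {k : Type*} [Field k] (A B : Set k) : Prop :=
  PolyReducible A B ∧ PolyReducible B A

/-- The polynomial class `[B]`, as a family of arbitrary subsets of `k`. -/
def polyClass {k : Type*} [Field k] (B : Set k) : Set (Set k) :=
  {A | PolyEquiv A B}

theorem PolyReducible.refl {k : Type*} [Field k] (A : Set k) : PolyReducible A A :=
  ⟨Polynomial.X, by ext; simp⟩

theorem PolyReducible.trans {k : Type*} [Field k] {A B C : Set k}
    (h : PolyReducible A B) (h' : PolyReducible B C) : PolyReducible A C := by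
  obtain ⟨P, rfl⟩ := h
  obtain ⟨Q, rfl⟩ := h'
  exact ⟨Q.comp P, by ext; simp⟩

/-! ### Affine space with its Zariski topology, affine varieties -/

/-- Affine space `k ^ n`; it carries the Zariski topology below. -/
abbrev AffSpace (k : Type*) (n : ℕ) : Type _ := Fin n → k

/-- The common zero set in `k ^ n` of a set of polynomials. -/
def zeros {k : Type*} [Field k] {n : ℕ} (S : Set (MvPolynomial (Fin n) k)) :
    Set (AffSpace k n) :=
  {x | ∀ p ∈ S, MvPolynomial.eval x p = 0}

/-- The Zariski topology: the closed sets are the zero sets of sets of polynomials. -/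
instance zariskiTopology (k : Type*) [Field k] (n : ℕ) : TopologicalSpace (AffSpace k n) :=
  TopologicalSpace.ofClosed {Z | ∃ S : Set (MvPolynomial (Fin n) k), Z = zeros S}
    ⟨{1}, by ext x; simp [zeros]⟩
    (by
      intro 𝒵 h𝒵
      refine ⟨{p | ∃ S : Set (MvPolynomial (Fin n) k), zeros S ∈ 𝒵 ∧ p ∈ S}, ?_⟩
      ext x
      simp only [Set.mem_sInter, zeros, Set.mem_ofPred_eq]
      constructor
      · rintro h p ⟨S, hS, hp⟩
        exact h _ hS p hp
      · intro h Z hZ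
        obtain ⟨S, rfl⟩ := h𝒵 hZ
        exact fun p hp => h p ⟨S, hZ, hp⟩)
    (by
      rintro _ ⟨S, rfl⟩ _ ⟨T, rfl⟩
      refine ⟨{p | ∃ s ∈ S, ∃ t ∈ T, p = s * t}, ?_⟩
      ext x
      simp only [Set.mem_union, zeros, Set.mem_ofPred_eq]
      constructor
      · rintro (h | h) _ ⟨s, hs, t, ht, rfl⟩
        · simp [h s hs]
        · simp [h t ht]
      · intro h
        by_contra hc
        push Not at hc
        obtain ⟨⟨s, hs, hs0⟩, t, ht, ht0⟩ := hc
        have := h _ ⟨s, hs, t, ht, rfl⟩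
        simp_all)

theorem isClosed_iff_zeros {k : Type*} [Field k] {n : ℕ} (Z : Set (AffSpace k n)) :
    IsClosed Z ↔ ∃ S : Set (MvPolynomial (Fin n) k), Z = zeros S := by
  rw [← isOpen_compl_iff]
  change Zᶜᶜ ∈ {Z | ∃ S : Set (MvPolynomial (Fin n) k), Z = zeros S} ↔ _
  rw [compl_compl]
  rfl

/-- A space `X` with a set `O` of `k`-valued functions is an affine variety over `k`, with
`O` as its ring of regular functions: it is isomorphic to a Zariski closed subset `V` of some
affine space `k ^ m`, with the induced topology, in such a way that the functions in `O` are
exactly the restrictions to `V` of polynomials. (Irreducibility is not part of the notion.) -/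
def IsAffineVariety (k : Type*) [Field k] (X : Type*) [TopologicalSpace X] (O : Set (X → k)) :
    Prop :=
  ∃ (m : ℕ) (V : Set (AffSpace k m)) (_ : IsClosed V) (e : X ≃ₜ V),
    ∀ F : X → k, F ∈ O ↔
      ∃ p : MvPolynomial (Fin m) k, ∀ x : X, F x = MvPolynomial.eval (e x : AffSpace k m) p

/-! ### The open set `D(f_n)` -/

/-- The polynomial `f_n = ∏_{j ≠ j'} (X_j - X_{j'})`. -/
noncomputable def f (k : Type*) [Field k] (n : ℕ) : MvPolynomial (Fin n) k :=
  ∏ p ∈ (Finset.univ : Finset (Fin n)).offDiag, (MvPolynomial.X p.1 - MvPolynomial.X p.2)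

/-- `D(f_n)`: the points of `k ^ n` with pairwise distinct coordinates, with the topology
induced by the Zariski topology of `k ^ n`. -/
abbrev D (k : Type*) (n : ℕ) : Type _ := {a : AffSpace k n // Function.Injective a}

theorem injective_iff_eval_f_ne_zero {k : Type*} [Field k] {n : ℕ} (a : AffSpace k n) :
    Function.Injective a ↔ MvPolynomial.eval a (f k n) ≠ 0 := by
  simp only [f, map_prod, map_sub, MvPolynomial.eval_X, Finset.prod_ne_zero_iff,
    Finset.mem_offDiag, Finset.mem_univ, true_and, sub_ne_zero, Prod.forall]
  exact ⟨fun h i j hij e => hij (h e), fun h i j e => by_contra fun hij => h i j hij e⟩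

/-- The regular functions on `D(f_n)`: those of the form `g / f_n ^ r`. -/
def regD (k : Type*) [Field k] (n : ℕ) : Set (D k n → k) :=
  {F | ∃ (g : MvPolynomial (Fin n) k) (r : ℕ), ∀ a : D k n,
    F a = MvPolynomial.eval a.1 g / MvPolynomial.eval a.1 (f k n) ^ r}

/-! ### The variety `𝒫_n` of `n`-element subsets of `k` -/

/-- The set `𝒫_n` of `n`-element subsets of `k`. -/
def P (k : Type*) (n : ℕ) : Type _ := {A : Set k // A.encard = n}

/-- The projection `θ : D(f_n) → 𝒫_n`, `(a_1, …, a_n) ↦ {a_1, …, a_n}`. Its fibres are the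
orbits of the symmetric group permuting the coordinates. -/
def θ (k : Type*) (n : ℕ) (a : D k n) : P k n :=
  ⟨Set.range (a.1 : Fin n → k), by
    rw [← Set.image_univ, a.2.encard_image]; simp⟩

/-- The quotient topology of `𝒫_n = D(f_n) / Sym_n`. -/
instance (k : Type*) [Field k] (n : ℕ) : TopologicalSpace (P k n) :=
  TopologicalSpace.coinduced (θ k n) inferInstance

/-- The regular functions on `𝒫_n = D(f_n) / Sym_n`: they correspond to the regular functions
on `D(f_n)` that are constant on the orbits of `Sym_n`. -/
def regP (k : Type*) [Field k] (n : ℕ) : Set (P k n → k) :=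
  {F | F ∘ θ k n ∈ regD k n}

/-- The polynomial class of `B`, as a subset of `𝒫_n`. -/
def classInP {k : Type*} [Field k] {n : ℕ} (B : P k n) : Set (P k n) :=
  {A | A.1 ∈ polyClass B.1}

/-! ### The variety `Σ_n` of polynomial classes of `n`-element sets -/

/-- The restriction of polynomial bireducibility to `𝒫_n`. -/
def polySetoid (k : Type*) [Field k] (n : ℕ) : Setoid (P k n) where
  r A B := PolyEquiv A.1 B.1
  iseqv :=
    { refl := fun A => ⟨PolyReducible.refl A.1, PolyReducible.refl A.1⟩
      symm := fun h => ⟨h.2, h.1⟩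
      trans := fun h h' => ⟨h.1.trans h'.1, h'.2.trans h.2⟩ }

/-- The quotient `Σ_n` of `𝒫_n` by polynomial bireducibility. -/
def Sig (k : Type*) [Field k] (n : ℕ) : Type _ := Quotient (polySetoid k n)

/-- The projection `θ' : 𝒫_n → Σ_n`. -/
def θ' (k : Type*) [Field k] (n : ℕ) (A : P k n) : Sig k n := Quotient.mk (polySetoid k n) A

/-- The quotient topology of `Σ_n`. -/
instance (k : Type*) [Field k] (n : ℕ) : TopologicalSpace (Sig k n) :=
  TopologicalSpace.coinduced (θ' k n) inferInstance

/-- The regular functions on `Σ_n`: they correspond to the regular functions on `𝒫_n` that are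
constant on polynomial classes. -/
def regSig (k : Type*) [Field k] (n : ℕ) : Set (Sig k n → k) :=
  {F | F ∘ θ' k n ∈ regP k n}

end PolyClass

/-! A polynomial map `R` of degree `d` with `R⁻¹(B) = B`, for `B` finite with at least two elements,
is linear: the fibres over `B` contribute `d * |B|` roots in `B` counted with multiplicity, while
only `d - 1` can be lost to ramification, so `d * |B| ≤ |B| + d - 1`. If `A` and `B` reduce to each
other through `P` and `Q`, this applies to `P ∘ Q`, so `P` has degree 1. Hence `≡ₚ` on `𝒫_n` is the
orbit relation of the affine group `x ↦ s x + t` (`polyEquiv_iff`).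

Write `n = m + 2`. The affine group acts freely on `D(f_n)`, and each orbit contains exactly one
tuple `(0, 1, c)`. These normalized tuples form a principal open set `W` of `k ^ m`, on which
`Sym_n` acts by permuting and normalizing again. Thus `𝒫_n = D(f_n) / Sym_n` and `Σ_n = W / Sym_n`
are both quotients of affine varieties by a finite group.

Such quotients are affine (`IsAffineAlgebra.descend`): the full algebra is integral over the
invariants, so finite generation passes down and characters extend upwards. The quotient map is
continuous and closed, and satisfies lifting and incomparability for irreducible closed sets, so it
preserves dimension. This gives `dim Σ_n = dim W = m`. A class `[B]` is a fibre of `θ'`, hence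
closed; it is also the image under `θ` of a closed copy of the affine group in `D(f_n)`, hence
irreducible of dimension 2. -/

namespace PolyClass

/-! ### Affine varieties through their function algebras; principal open sets -/

open MvPolynomial Topology

/-- An intrinsic description of affine varieties: `O` is a finitely generated algebra of
functions on `X` that separates points, whose zero sets are the closed sets of `X` and whose
characters are the evaluations at points of `X`. -/
structure IsAffineAlgebra {k X : Type*} [Field k] [TopologicalSpace X]
    (O : Subalgebra k (X → k)) : Prop where
  fg : O.FG
  isClosed_iff : ∀ Z : Set X, IsClosed Z ↔
    ∃ S ⊆ (O : Set (X → k)), Z = {x | ∀ F ∈ S, F x = 0}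
  separates : ∀ x y : X, (∀ F ∈ O, F x = F y) → x = y
  exists_eval : ∀ φ : O →ₐ[k] k, ∃ x : X, ∀ F : O, φ F = F.1 x

theorem aeval_apply_eq_eval {k X ι : Type*} [Field k] (g : ι → X → k) (p : MvPolynomial ι k)
    (x : X) : aeval g p x = eval (fun i => g i x) p := by
  have : (Pi.evalAlgHom k (fun _ : X => k) x).comp (aeval g) = aeval (fun i => g i x) := by
    ext i; simp
  have h := DFunLike.congr_fun this p
  simpa [aeval_eq_eval] using h

theorem isClosed_zeros {k : Type*} [Field k] {n : ℕ} (S : Set (MvPolynomial (Fin n) k)) :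
    IsClosed (zeros S) := (isClosed_iff_zeros _).2 ⟨S, rfl⟩

theorem isClosed_zero {k : Type*} [Field k] {n : ℕ} (p : MvPolynomial (Fin n) k) :
    IsClosed {x : AffSpace k n | eval x p = 0} := by
  convert isClosed_zeros {p}
  simp [zeros]

/-- A map to affine space whose coordinates lie in an algebra of functions with closed zero
sets is continuous. -/
theorem continuous_of_regular {k X : Type*} [Field k] [TopologicalSpace X] {m : ℕ}
    (O : Subalgebra k (X → k)) (hO : ∀ F ∈ O, IsClosed {x | F x = 0})
    (φ : X → AffSpace k m) (hφ : ∀ i, (fun x => φ x i) ∈ O) : Continuous φ := by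
  refine continuous_iff_isClosed.2 fun Z hZ => ?_
  obtain ⟨S, rfl⟩ := (isClosed_iff_zeros Z).1 hZ
  have : φ ⁻¹' zeros S = ⋂ p ∈ S, {x | aeval (fun i x => φ x i) p x = 0} := by
    ext x; simp [zeros, aeval_apply_eq_eval]
  rw [this]
  refine isClosed_biInter fun p _ => hO _ ?_
  have : aeval (fun i x => φ x i) p ∈ (aeval (R := k) (fun i x => φ x i)).range := ⟨p, rfl⟩
  rw [← Algebra.adjoin_range_eq_range_aeval] at this
  exact Algebra.adjoin_le (by rintro _ ⟨i, rfl⟩; exact hφ i) this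

theorem IsAffineAlgebra.isClosed_zero {k X : Type*} [Field k] [TopologicalSpace X]
    {O : Subalgebra k (X → k)} (h : IsAffineAlgebra O) {F : X → k} (hF : F ∈ O) :
    IsClosed {x | F x = 0} :=
  (h.isClosed_iff _).2 ⟨{F}, by simpa using hF, by simp⟩

theorem IsAffineAlgebra.isClosed_singleton {k X : Type*} [Field k] [TopologicalSpace X]
    {O : Subalgebra k (X → k)} (h : IsAffineAlgebra O) (x : X) : IsClosed {x} := by
  refine (h.isClosed_iff _).2 ⟨{F | F ∈ O ∧ F x = 0}, fun F hF => hF.1, ?_⟩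
  ext y
  refine ⟨by rintro rfl; exact fun F hF => hF.2, fun hy => h.separates _ _ fun F hF => ?_⟩
  have := hy (F - algebraMap k (X → k) (F x))
    ⟨O.sub_mem hF (O.algebraMap_mem _), by simp⟩
  simpa [sub_eq_zero] using this

/-- Finitely many generators of `O` serve as coordinates of an embedding. -/
theorem IsAffineAlgebra.isAffineVariety {k X : Type*} [Field k] [TopologicalSpace X]
    {O : Subalgebra k (X → k)} (h : IsAffineAlgebra O) :
    IsAffineVariety k X (O : Set (X → k)) := by
  obtain ⟨s, hs⟩ := h.fg
  let g : Fin s.card → X → k := fun i => s.equivFin.symm i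
  have hg : Set.range g = s := by
    ext F
    constructor
    · rintro ⟨i, rfl⟩; exact (s.equivFin.symm i).2
    · intro hF; exact ⟨s.equivFin ⟨F, hF⟩, by simp [g]⟩
  have hO : O = (aeval (R := k) g).range := by
    rw [← Algebra.adjoin_range_eq_range_aeval, hg, hs]
  have hmem : ∀ p, aeval g p ∈ O := fun p => by rw [hO]; exact ⟨p, rfl⟩
  let e : X → AffSpace k s.card := fun x i => g i x
  have he : ∀ p x, aeval g p x = eval (e x) p := aeval_apply_eq_eval g
  have hcont : Continuous e := by
    refine continuous_of_regular O (fun F => h.isClosed_zero) e fun i => ?_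
    simpa using hmem (MvPolynomial.X i)
  have hemb : IsEmbedding e := by
    refine ⟨⟨TopologicalSpace.ext_isClosed fun Z => ?_⟩, fun x y hxy => ?_⟩
    · rw [isClosed_induced_iff]
      refine ⟨fun hZ => ?_, by rintro ⟨T, hT, rfl⟩; exact hT.preimage hcont⟩
      obtain ⟨S, hS, rfl⟩ := (h.isClosed_iff Z).1 hZ
      refine ⟨zeros {p | aeval g p ∈ S}, isClosed_zeros _, ?_⟩
      ext x
      simp only [zeros, Set.mem_preimage, Set.mem_ofPred_eq, ← he]
      refine ⟨fun hx F hF => ?_, fun hx p hp => hx _ hp⟩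
      obtain ⟨p, rfl⟩ := hO.le (hS hF)
      exact hx p hF
    · refine h.separates _ _ fun F hF => ?_
      obtain ⟨p, rfl⟩ := hO.le hF
      exact (he p x).trans (hxy ▸ (he p y).symm)
  refine ⟨s.card, Set.range e, ?_, hemb.toHomeomorph, fun F => ?_⟩
  · have : Set.range e = zeros {p | aeval g p = 0} := by
      ext v
      constructor
      · rintro ⟨x, rfl⟩ p hp
        rw [← he, show aeval g p = 0 from hp]; rfl
      -- A point satisfying every relation between the generators defines a character of `O`;
      -- characters are evaluations, so the point lies in the image.
      · intro hv
        let q : MvPolynomial (Fin s.card) k →ₐ[k] O := (aeval g).codRestrict O hmem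
        have hq : Function.Surjective q := by
          rintro ⟨F, hF⟩
          obtain ⟨p, rfl⟩ := hO.le hF
          exact ⟨p, rfl⟩
        let φ : O →ₐ[k] k := AlgHom.liftOfSurjective q hq (aeval v) (by
          intro p hp
          have : aeval g p = 0 := congrArg Subtype.val hp
          simpa [aeval_eq_eval] using hv p this)
        obtain ⟨x, hx⟩ := h.exists_eval φ
        refine ⟨x, funext fun i => ?_⟩
        have h1 : φ (q (MvPolynomial.X i)) = v i := by simp [φ]
        rw [← h1, hx]
        simp [q, e]
    rw [this]; exact isClosed_zeros _
  · rw [SetLike.mem_coe, hO]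
    refine ⟨?_, ?_⟩
    · rintro ⟨p, rfl⟩; exact ⟨p, he p⟩
    · rintro ⟨p, hp⟩; exact ⟨p, funext fun x => by rw [hp x]; exact he p x⟩

/-- The algebra of regular functions on the open subset of affine space defined by `h ≠ 0`,
generated by the coordinates and by `1 / h`. -/
def principalAlgebra {k : Type*} [Field k] {n : ℕ} (p : AffSpace k n → Prop)
    (h : MvPolynomial (Fin n) k) : Subalgebra k ({x // p x} → k) :=
  Algebra.adjoin k (insert (fun a => (eval a.1 h)⁻¹) (Set.range fun i a => a.1 i))

section Principal

variable {k : Type*} [Field k] {n : ℕ} {p : AffSpace k n → Prop} {h : MvPolynomial (Fin n) k}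

theorem coord_mem_principalAlgebra (i : Fin n) :
    (fun a => a.1 i) ∈ principalAlgebra p h := Algebra.subset_adjoin (Or.inr ⟨i, rfl⟩)

theorem inv_mem_principalAlgebra :
    (fun a => (eval a.1 h)⁻¹) ∈ principalAlgebra p h := Algebra.subset_adjoin (Or.inl rfl)

theorem eval_mem_principalAlgebra (g : MvPolynomial (Fin n) k) :
    (fun a => eval a.1 g) ∈ principalAlgebra p h := by
  have : (fun a : {x // p x} => eval a.1 g) = aeval (fun i (a : {x // p x}) => a.1 i) g := by
    ext a; rw [aeval_apply_eq_eval]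
  rw [this]
  have : aeval (fun i (a : {x // p x}) => a.1 i) g ∈
    (aeval (R := k) (fun i (a : {x // p x}) => a.1 i)).range := ⟨g, rfl⟩
  rw [← Algebra.adjoin_range_eq_range_aeval] at this
  exact Algebra.adjoin_mono (Set.subset_insert _ _) this

theorem mem_principalAlgebra_iff (hp : ∀ x, p x ↔ eval x h ≠ 0) (F : {x // p x} → k) :
    F ∈ principalAlgebra p h ↔
      ∃ (g : MvPolynomial (Fin n) k) (r : ℕ), ∀ a, F a = eval a.1 g / eval a.1 h ^ r := by
  constructor
  · intro hF
    refine Algebra.adjoin_induction (p := fun F _ => ∃ (g : MvPolynomial (Fin n) k) (r : ℕ),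
      ∀ a : {x // p x}, F a = eval a.1 g / eval a.1 h ^ r) ?_ ?_ ?_ ?_ hF
    · rintro F (rfl | ⟨i, rfl⟩)
      · exact ⟨1, 1, by simp⟩
      · exact ⟨X i, 0, by simp⟩
    · intro c; exact ⟨C c, 0, by simp⟩
    · rintro F F' _ _ ⟨g, r, hg⟩ ⟨g', r', hg'⟩
      refine ⟨g * h ^ r' + g' * h ^ r, r + r', fun a => ?_⟩
      have := (hp a.1).1 a.2
      simp only [Pi.add_apply, hg, hg', map_add, map_mul, map_pow]
      rw [div_add_div _ _ (pow_ne_zero _ this) (pow_ne_zero _ this), pow_add]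
      ring
    · rintro F F' _ _ ⟨g, r, hg⟩ ⟨g', r', hg'⟩
      refine ⟨g * g', r + r', fun a => ?_⟩
      simp only [Pi.mul_apply, hg, hg', map_mul, pow_add, mul_div_mul_comm]
  · rintro ⟨g, r, hF⟩
    have : F = (fun a => eval a.1 g) * (fun a => (eval a.1 h)⁻¹) ^ r := by
      ext a; simp [hF, div_eq_mul_inv]
    rw [this]
    exact mul_mem (eval_mem_principalAlgebra g) (pow_mem inv_mem_principalAlgebra r)

theorem isAffineAlgebra_principalAlgebra (hp : ∀ x, p x ↔ eval x h ≠ 0) :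
    IsAffineAlgebra (principalAlgebra p h) where
  fg := by
    refine Subalgebra.fg_def.2 ⟨_, (Set.finite_range _).insert _, rfl⟩
  isClosed_iff Z := by
    constructor
    · intro hZ
      obtain ⟨T, hT, rfl⟩ := isClosed_induced_iff.1 hZ
      obtain ⟨S, rfl⟩ := (isClosed_iff_zeros T).1 hT
      refine ⟨(fun g a => eval a.1 g) '' S, ?_, ?_⟩
      · rintro _ ⟨g, _, rfl⟩; exact eval_mem_principalAlgebra g
      · ext x; simp [zeros]
    · rintro ⟨S, hS, rfl⟩
      simp only [Set.ofPred_forall]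
      refine isClosed_biInter fun F hF => ?_
      obtain ⟨g, r, hg⟩ := (mem_principalAlgebra_iff hp F).1 (hS hF)
      convert (isClosed_zero g).preimage continuous_subtype_val using 1
      ext a
      simp [hg, (hp a.1).1 a.2]
  separates x y hxy := Subtype.ext (funext fun i => hxy _ (coord_mem_principalAlgebra i))
  exists_eval φ := by
    let c : MvPolynomial (Fin n) k →ₐ[k] principalAlgebra p h :=
      (aeval fun i (a : {x // p x}) => a.1 i).codRestrict _ fun g => by
        convert eval_mem_principalAlgebra (p := p) (h := h) g using 1
        ext a; rw [aeval_apply_eq_eval]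
    have hc : ∀ g a, (c g).1 a = eval a.1 g := fun g a => aeval_apply_eq_eval _ _ _
    let u : principalAlgebra p h := ⟨_, inv_mem_principalAlgebra⟩
    let v : AffSpace k n := fun i => φ (c (X i))
    have hv : ∀ g, φ (c g) = eval v g := by
      intro g
      have : φ.comp c = aeval v := by ext i; simp [v]
      simpa [aeval_eq_eval] using DFunLike.congr_fun this g
    -- The images `v` of the coordinates determine the character. Since `h` is invertible in the
    -- algebra, it cannot vanish at `v`, so `v` lies in the open set.
    have hinv : eval v h * φ u = 1 := by
      rw [← hv, ← map_mul, ← map_one φ]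
      refine congrArg φ (Subtype.ext (funext fun a => ?_))
      change (c h).1 a * (eval a.1 h)⁻¹ = 1
      rw [hc, mul_inv_cancel₀ ((hp a.1).1 a.2)]
    have hvp : p v := (hp v).2 (left_ne_zero_of_mul_eq_one hinv)
    refine ⟨⟨v, hvp⟩, fun F => ?_⟩
    obtain ⟨g, r, hg⟩ := (mem_principalAlgebra_iff hp F.1).1 F.2
    have : F = c g * u ^ r := Subtype.ext (funext fun a => by
      change F.1 a = (c g).1 a * (u.1 a) ^ r
      rw [hg, hc, div_eq_mul_inv, ← inv_pow])
    conv_lhs => rw [this]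
    rw [map_mul, map_pow, hv, hg, div_eq_mul_inv, ← inv_pow, eq_inv_of_mul_eq_one_right hinv]

end Principal

end PolyClass

namespace PolyClass

/-! ### Quotients of affine varieties by finite groups -/

open Topology

/-- Pullback of functions along `π`. -/
def pullback (k : Type*) [Field k] {X Y : Type*} (π : X → Y) : (Y → k) →ₐ[k] (X → k) where
  toFun F := F ∘ π
  map_one' := rfl
  map_mul' _ _ := rfl
  map_zero' := rfl
  map_add' _ _ := rfl
  commutes' _ := rfl

/-- The functions on `Y` whose composition with `π` lies in `O`. -/
def descend {k : Type*} [Field k] {X Y : Type*} (π : X → Y) (O : Subalgebra k (X → k)) :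
    Subalgebra k (Y → k) := O.comap (pullback k π)

theorem mem_descend {k : Type*} [Field k] {X Y : Type*} {π : X → Y} {O : Subalgebra k (X → k)}
    {F : Y → k} : F ∈ descend π O ↔ F ∘ π ∈ O := Iff.rfl

section FiniteQuotient

variable {k X Y G : Type*} [Field k] [Group G] [MulAction G X] {O : Subalgebra k (X → k)}
  {π : X → Y}

/-- The action of a group on an algebra of functions, induced by an action on the space. -/
abbrev functionAction (hG : ∀ (g : G), ∀ F ∈ O, (fun x => F (g • x)) ∈ O) :
    MulSemiringAction G O where
  smul g F := ⟨fun x => F.1 (g⁻¹ • x), hG _ _ F.2⟩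
  one_smul F := Subtype.ext (funext fun x => congrArg F.1 (by simp))
  mul_smul g h F := Subtype.ext (funext fun x => congrArg F.1 (by simp [mul_smul]))
  smul_zero _ := rfl
  smul_add _ _ _ := rfl
  smul_one _ := rfl
  smul_mul _ _ _ := rfl

theorem exists_descend_of_invariant (hsurj : Function.Surjective π)
    (hfib : ∀ x y, π x = π y ↔ ∃ g : G, g • x = y) {F : X → k} (hF : F ∈ O)
    (hinv : ∀ (g : G) x, F (g • x) = F x) : ∃ F' ∈ descend π O, F' ∘ π = F := by
  have h : (fun y => F (Function.surjInv hsurj y)) ∘ π = F := by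
    funext x
    obtain ⟨g, hg⟩ := (hfib _ _).1 (Function.surjInv_eq hsurj (π x)).symm
    simp only [Function.comp_apply]
    rw [← hg, hinv]
  exact ⟨_, mem_descend.2 (h.symm ▸ hF), h⟩

/-- A point outside an invariant set which is cut out by functions is separated from it by
invariant functions. -/
theorem exists_invariant_ne_zero [Finite G]
    (hG : ∀ (g : G), ∀ F ∈ O, (fun x => F (g • x)) ∈ O) {Z : Set X}
    (hZ : ∀ (g : G), ∀ x ∈ Z, g • x ∈ Z) {x : X} {F : X → k} (hF : F ∈ O)
    (hFZ : ∀ z ∈ Z, F z = 0) (hx : F x ≠ 0) :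
    ∃ H ∈ O, (∀ (g : G) y, H (g • y) = H y) ∧ (∀ z ∈ Z, H z = 0) ∧ H x ≠ 0 := by
  let := functionAction hG
  have := Fintype.ofFinite G
  let ev : X → O →+* k := fun y => (Pi.evalRingHom (fun _ => k) y).comp O.subtype
  -- The coefficients of `∏ (T - g F)` are invariant, and the non-leading ones vanish on `Z`. If
  -- they all vanished at `x` too, the polynomial there would be `T ^ |G|`, contradicting its
  -- nonzero root `F x`.
  let c := MulSemiringAction.charpoly G (⟨F, hF⟩ : O)
  have hc : ∀ y, c.map (ev y) = ∏ g : G, (Polynomial.X - Polynomial.C (F (g⁻¹ • y))) := by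
    intro y
    simp only [c, MulSemiringAction.charpoly_eq, Polynomial.map_prod, Polynomial.map_sub,
      Polynomial.map_X, Polynomial.map_C]
    rfl
  by_contra hcon
  push Not at hcon
  have hdeg : c.natDegree = Fintype.card G := by
    have := congrArg Polynomial.natDegree (hc x)
    rw [(MulSemiringAction.monic_charpoly G _).natDegree_map] at this
    rw [this, Polynomial.natDegree_finsetProd_X_sub_C_eq_card]
    rfl
  have hcx : c.map (ev x) = Polynomial.X ^ Fintype.card G := by
    ext i
    rw [Polynomial.coeff_map, Polynomial.coeff_X_pow]
    split_ifs with hi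
    · subst hi
      rw [← hdeg, (MulSemiringAction.monic_charpoly G _).coeff_natDegree, map_one]
    · refine hcon (c.coeff i).1 (c.coeff i).2 (fun g y => ?_) fun z hz => ?_
      · have := MulSemiringAction.smul_coeff_charpoly (G := G) (⟨F, hF⟩ : O) i g⁻¹
        have := congrFun (congrArg Subtype.val this) y
        change (c.coeff i).1 (g⁻¹⁻¹ • y) = _ at this
        rwa [inv_inv] at this
      · have h1 : c.map (ev z) = Polynomial.X ^ Fintype.card G := by
          rw [hc, Finset.prod_congr rfl (g := fun _ => Polynomial.X) fun g _ => by
            rw [hFZ _ (hZ _ _ hz), map_zero, sub_zero]]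
          simp
        have := congrArg (fun p => Polynomial.coeff p i) h1
        simp only [Polynomial.coeff_map, Polynomial.coeff_X_pow, if_neg hi] at this
        exact this
  have := congrArg (Polynomial.eval (F x)) hcx
  rw [hc, Polynomial.eval_prod, Finset.prod_eq_zero (Finset.mem_univ 1) (by simp)] at this
  rw [Polynomial.eval_pow, Polynomial.eval_X] at this
  exact pow_ne_zero _ hx this.symm

variable [TopologicalSpace X] [TopologicalSpace Y] [Finite G]

/-- Two characters with the same kernel agree. -/
theorem algHom_eq_of_ker_le {A : Type*} [CommRing A] [Algebra k A] (φ ψ : A →ₐ[k] k)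
    (h : ∀ a, φ a = 0 → ψ a = 0) : φ = ψ := by
  ext a
  have := h (a - algebraMap k A (φ a)) (by simp)
  rw [map_sub, sub_eq_zero] at this
  simpa using this.symm

/-- A character extends along an integral extension of finitely generated algebras over an
algebraically closed field. -/
theorem exists_character_extension [IsAlgClosed k] {A B : Type*} [CommRing A] [CommRing B]
    [Algebra k A] [Algebra k B] [Algebra A B] [IsScalarTower k A B] [Algebra.IsIntegral A B]
    [Algebra.FiniteType k B] (hinj : Function.Injective (algebraMap A B)) (φ : A →ₐ[k] k) :
    ∃ ψ : B →ₐ[k] k, ∀ a, ψ (algebraMap A B a) = φ a := by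
  have hmax : (RingHom.ker φ).IsMaximal :=
    RingHom.ker_isMaximal_of_surjective φ fun c => ⟨algebraMap k A c, by simp⟩
  -- A maximal ideal lying over `ker φ` has residue field `k` by the Nullstellensatz; the resulting
  -- character restricts to `φ` because it kills `ker φ`.
  obtain ⟨Q, hQ, hQφ⟩ := Ideal.exists_ideal_over_maximal_of_isIntegral (S := B) (RingHom.ker φ)
    (by rw [(RingHom.injective_iff_ker_eq_bot _).1 hinj]; exact bot_le)
  let := Ideal.Quotient.field Q
  have := finite_of_finite_type_of_isJacobsonRing k (B ⧸ Q)
  let e : k ≃ₐ[k] B ⧸ Q := AlgEquiv.ofBijective (Algebra.ofId k _)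
    IsAlgClosed.algebraMap_bijective_of_isIntegral
  let ψ : B →ₐ[k] k := e.symm.toAlgHom.comp (Ideal.Quotient.mkₐ k Q)
  refine ⟨ψ, fun a => ?_⟩
  have : φ = ψ.comp (IsScalarTower.toAlgHom k A B) := by
    refine algHom_eq_of_ker_le _ _ fun a ha => ?_
    have h1 : algebraMap A B a ∈ Q := by
      rw [← Ideal.mem_comap, hQφ]; exact ha
    have h2 : Ideal.Quotient.mkₐ k Q (algebraMap A B a) = 0 := Ideal.Quotient.eq_zero_iff_mem.2 h1
    change e.symm (Ideal.Quotient.mkₐ k Q (algebraMap A B a)) = 0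
    rw [h2, map_zero]
  rw [this]; rfl

/-- The quotient of an affine variety by a finite group is an affine variety. -/
theorem IsAffineAlgebra.descend [IsAlgClosed k] (hO : IsAffineAlgebra O)
    (hG : ∀ (g : G), ∀ F ∈ O, (fun x => F (g • x)) ∈ O) (hπ : IsQuotientMap π)
    (hfib : ∀ x y, π x = π y ↔ ∃ g : G, g • x = y) :
    IsAffineAlgebra (descend π O) := by
  have hsep : ∀ (Z : Set Y), IsClosed (π ⁻¹' Z) → ∀ y ∉ Z,
      ∃ F ∈ PolyClass.descend π O, (∀ z ∈ Z, F z = 0) ∧ F y ≠ 0 := by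
    intro Z hZ y hy
    obtain ⟨x, rfl⟩ := hπ.surjective y
    obtain ⟨S, hS, hSZ⟩ := (hO.isClosed_iff _).1 hZ
    have : x ∉ π ⁻¹' Z := hy
    rw [hSZ] at this
    simp only [Set.mem_ofPred_eq, not_forall] at this
    obtain ⟨F, hF, hFx⟩ := this
    obtain ⟨H, hH, hinv, hHZ, hHx⟩ := exists_invariant_ne_zero hG (Z := π ⁻¹' Z)
      (fun g x hx => by rw [Set.mem_preimage, ← (hfib x (g • x)).2 ⟨g, rfl⟩]; exact hx)
      (hS hF) (fun z hz => by rw [hSZ] at hz; exact hz F hF) hFx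
    obtain ⟨H', hH', rfl⟩ := exists_descend_of_invariant hπ.surjective hfib hH hinv
    refine ⟨H', hH', fun z hz => ?_, hHx⟩
    obtain ⟨w, rfl⟩ := hπ.surjective z
    exact hHZ w hz
  let := functionAction hG
  let ι : PolyClass.descend π O →ₐ[k] O :=
    ((pullback k π).comp (PolyClass.descend π O).val).codRestrict O fun F => F.2
  let : Algebra (PolyClass.descend π O) O := ι.toRingHom.toAlgebra
  have hι : Function.Injective (algebraMap (PolyClass.descend π O) O) := fun F F' h =>
    Subtype.ext (hπ.surjective.injective_comp_right (congrArg Subtype.val h))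
  have : IsScalarTower k (PolyClass.descend π O) O := IsScalarTower.of_algebraMap_eq fun _ => rfl
  have : Algebra.IsInvariant (PolyClass.descend π O) O G := ⟨fun F hF => by
    obtain ⟨F', hF', h⟩ := exists_descend_of_invariant hπ.surjective hfib F.2 fun g x => by
      have := congrFun (congrArg Subtype.val (hF g⁻¹)) x
      change F.1 (g⁻¹⁻¹ • x) = F.1 x at this
      rwa [inv_inv] at this
    exact ⟨⟨F', hF'⟩, Subtype.ext h⟩⟩
  have : Algebra.IsIntegral (PolyClass.descend π O) O := Algebra.IsInvariant.isIntegral _ _ G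
  have hft : Algebra.FiniteType k O := ⟨O.fg_top.2 hO.fg⟩
  have : Algebra.FiniteType (PolyClass.descend π O) O :=
    Algebra.FiniteType.of_restrictScalars_finiteType k _ _
  have : Module.Finite (PolyClass.descend π O) O := Algebra.IsIntegral.finite
  constructor
  · rw [← Subalgebra.fg_top]
    -- Artin–Tate: `O` is finitely generated over `k` and module-finite over the invariants.
    exact fg_of_fg_of_fg k _ O hft.out Module.Finite.fg_top hι
  · intro Z
    rw [← hπ.isClosed_preimage]
    constructor
    · intro hZ
      refine ⟨{F | F ∈ PolyClass.descend π O ∧ ∀ z ∈ Z, F z = 0}, fun F hF => hF.1, ?_⟩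
      ext y
      refine ⟨fun hy F hF => hF.2 y hy, fun hy => ?_⟩
      by_contra hyZ
      obtain ⟨F, hF, hFZ, hFy⟩ := hsep Z hZ y hyZ
      exact hFy (hy F ⟨hF, hFZ⟩)
    · rintro ⟨S, hS, rfl⟩
      refine (hO.isClosed_iff _).2 ⟨(· ∘ π) '' S, ?_, ?_⟩
      · rintro _ ⟨F, hF, rfl⟩; exact hS hF
      · ext x; simp
  · intro y₁ y₂ h
    by_contra hne
    obtain ⟨x, rfl⟩ := hπ.surjective y₁
    have : IsClosed (π ⁻¹' {π x}) := by
      have : π ⁻¹' {π x} = ⋃ g : G, {g • x} := by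
        ext z
        simp only [Set.mem_preimage, Set.mem_singleton_iff, Set.mem_iUnion]
        rw [eq_comm, hfib]
        simp only [eq_comm]
      rw [this]
      exact isClosed_iUnion_of_finite fun g => hO.isClosed_singleton _
    obtain ⟨F, hF, hF0, hF1⟩ := hsep _ this y₂ (fun h => hne (h : y₂ = π x).symm)
    exact hF1 ((h F hF).symm.trans (hF0 _ rfl))
  · intro φ
    obtain ⟨ψ, hψ⟩ := exists_character_extension hι φ
    obtain ⟨x, hx⟩ := hO.exists_eval ψ
    exact ⟨π x, fun F => (hψ F).symm.trans (hx _)⟩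

end FiniteQuotient

end PolyClass

namespace PolyClass

/-! ### Zariski topology and dimension of affine space -/

open Topology TopologicalSpace

section AffineSpace

open MvPolynomial

variable {k : Type*} [Field k] {m : ℕ}

theorem exists_eval_ne_zero_subset {U : Set (AffSpace k m)} (hU : IsOpen U) {x : AffSpace k m}
    (hx : x ∈ U) : ∃ p : MvPolynomial (Fin m) k, eval x p ≠ 0 ∧ ∀ y, eval y p ≠ 0 → y ∈ U := by
  obtain ⟨S, hS⟩ := (isClosed_iff_zeros _).1 hU.isClosed_compl
  have : x ∉ zeros S := hS ▸ fun h => h hx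
  simp only [zeros, Set.mem_ofPred_eq, not_forall] at this
  obtain ⟨p, hp, hpx⟩ := this
  refine ⟨p, hpx, fun y hy => by_contra fun hyU => hy ?_⟩
  have : y ∈ zeros S := hS ▸ hyU
  exact this p hp

instance irreducibleSpace_affSpace [Infinite k] : IrreducibleSpace (AffSpace k m) where
  toNonempty := ⟨0⟩
  isPreirreducible_univ := by
    rintro U V hU hV ⟨x, -, hx⟩ ⟨y, -, hy⟩
    obtain ⟨p, hp, hpU⟩ := exists_eval_ne_zero_subset hU hx
    obtain ⟨q, hq, hqV⟩ := exists_eval_ne_zero_subset hV hy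
    have hpq : p * q ≠ 0 := mul_ne_zero (by rintro rfl; simp at hp) (by rintro rfl; simp at hq)
    obtain ⟨z, hz⟩ : ∃ z, eval z (p * q) ≠ 0 := by
      by_contra h
      push Not at h
      exact hpq (MvPolynomial.funext fun z => by simpa using h z)
    rw [map_mul] at hz
    exact ⟨z, trivial, hpU z (left_ne_zero_of_mul hz), hqV z (right_ne_zero_of_mul hz)⟩

/-- The map from affine space to the prime spectrum of the polynomial ring. -/
noncomputable def toPrimeSpectrum (x : AffSpace k m) : PrimeSpectrum (MvPolynomial (Fin m) k) :=
  ⟨RingHom.ker (eval x), RingHom.ker_isPrime _⟩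

/-- Zero loci pull back to zero sets. Affine space thereby inherits noetherianity and the bound `dim
≤ m` from the spectrum of the polynomial ring. -/
theorem isInducing_toPrimeSpectrum : IsInducing (toPrimeSpectrum : AffSpace k m → _) := by
  refine ⟨TopologicalSpace.ext_isClosed fun Z => ?_⟩
  have key : ∀ S, toPrimeSpectrum ⁻¹' PrimeSpectrum.zeroLocus S = zeros (k := k) (n := m) S :=
    fun _ => rfl
  rw [isClosed_induced_iff, isClosed_iff_zeros]
  constructor
  · rintro ⟨S, rfl⟩
    exact ⟨_, PrimeSpectrum.isClosed_zeroLocus S, key S⟩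
  · rintro ⟨T, hT, rfl⟩
    obtain ⟨S, rfl⟩ := (PrimeSpectrum.isClosed_iff_zeroLocus _).1 hT
    exact ⟨S, key S⟩

instance : NoetherianSpace (AffSpace k m) := isInducing_toPrimeSpectrum.noetherianSpace

theorem topologicalKrullDim_affSpace_le : topologicalKrullDim (AffSpace k m) ≤ m := by
  refine isInducing_toPrimeSpectrum.topologicalKrullDim_le.trans ?_
  rw [PrimeSpectrum.topologicalKrullDim_eq_ringKrullDim, ringKrullDim_of_isNoetherianRing,
    ringKrullDim_eq_zero_of_field]
  simp

/-- Maps between affine spaces with polynomial coordinates are continuous. -/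
theorem continuous_of_eval {l : ℕ} (q : Fin l → MvPolynomial (Fin m) k)
    (φ : AffSpace k m → AffSpace k l) (hφ : ∀ x i, φ x i = eval x (q i)) : Continuous φ := by
  refine continuous_iff_isClosed.2 fun Z hZ => ?_
  obtain ⟨S, rfl⟩ := (isClosed_iff_zeros Z).1 hZ
  have : φ ⁻¹' zeros S = zeros (bind₁ q '' S) := by
    have h : ∀ x p, eval (φ x) p = eval x (bind₁ q p) := fun x p => by
      rw [funext (hφ x)]
      induction p using MvPolynomial.induction_on <;> simp_all
    ext x
    simp [zeros, h]
  rw [this]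
  exact isClosed_zeros _

/-- The dimension of a nonempty open subset of affine space. -/
theorem topologicalKrullDim_of_isOpen [Infinite k] {U : Set (AffSpace k m)} (hU : IsOpen U)
    (hne : U.Nonempty) : topologicalKrullDim U = m := by
  refine le_antisymm ((topologicalKrullDim_subspace_le _ U).trans
    topologicalKrullDim_affSpace_le) ?_
  obtain ⟨c, hc⟩ := hne
  -- A flag of linear subspaces through `c`: in `L i` the first `i` coordinates are free. Its traces
  -- on `U` form a chain of length `m`.
  let L : ℕ → Set (AffSpace k m) := fun i => {x | ∀ j : Fin m, i ≤ j → x j = c j}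
  have hclosed : ∀ i, IsClosed (L i) := fun i => by
    simp only [L, Set.ofPred_forall]
    refine isClosed_iInter fun j => isClosed_iInter fun _ => ?_
    convert isClosed_zero (X j - C (c j)) using 1
    ext x; simp [sub_eq_zero]
  have hirr : ∀ i, IsIrreducible (L i) := fun i => by
    let φ : AffSpace k m → AffSpace k m := fun x j => if (j : ℕ) < i then x j else c j
    have hφ : Continuous φ := by
      refine continuous_of_eval (fun j => if (j : ℕ) < i then X j else C (c j)) φ fun x j => ?_
      simp only [φ]
      split_ifs <;> simp
    have : L i = φ '' Set.univ := by
      ext x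
      simp only [L, Set.mem_ofPred_eq, Set.image_univ, Set.mem_range, φ]
      constructor
      · intro hx
        refine ⟨x, funext fun j => ?_⟩
        split_ifs with h
        · rfl
        · exact (hx j (not_lt.1 h)).symm
      · rintro ⟨y, rfl⟩ j hj
        exact if_neg (not_lt.2 hj)
    rw [this]
    exact (IrreducibleSpace.isIrreducible_univ _).image φ hφ.continuousOn
  have hcL : ∀ i, c ∈ L i := fun i j _ => rfl
  let Z : ℕ → IrreducibleCloseds U := fun i =>
    ⟨Subtype.val ⁻¹' L i, ⟨⟨⟨c, hc⟩, hcL i⟩, (hirr i).2.preimage hU.isOpenEmbedding_subtypeVal⟩,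
      (hclosed i).preimage continuous_subtype_val⟩
  have hlt : ∀ i : Fin m, Z i < Z (i + 1) := fun i => by
    refine lt_of_le_of_ne (fun x hx j hj => hx j (by omega)) fun heq => ?_
    have hV : IsOpen {x : AffSpace k m | x i = c i}ᶜ := by
      rw [isOpen_compl_iff]
      convert isClosed_zero (X i - C (c i)) using 1
      ext x; simp [sub_eq_zero]
    -- By irreducibility `L (i + 1)` meets `U` at a point whose coordinate `i` differs from `c i`,
    -- so the inclusion is strict inside `U` as well.
    obtain ⟨y, hyL, hyU, hyV⟩ := (hirr (i + 1)).2 U _ hU hV ⟨c, hcL _, hc⟩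
      ⟨Function.update c i (c i + 1), fun j hj => Function.update_of_ne
        (by rintro rfl; omega) _ _, by simp⟩
    have : (⟨y, hyU⟩ : U) ∈ (Z i).carrier := by rw [heq]; exact hyL
    exact hyV (this i le_rfl)
  let s : LTSeries (IrreducibleCloseds U) :=
    { length := m
      toFun := fun i => Z i
      step := fun i => by simpa using hlt i }
  exact le_iSup (fun s : LTSeries _ => (s.length : WithBot ℕ∞)) s

end AffineSpace

/-! ### Dimension under closed maps and finite quotients -/

section Dimension

variable {X Y : Type*} [TopologicalSpace X] [TopologicalSpace Y]

/-- An irreducible closed subset of the image of a closed set `A` under a closed map is the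
image of an irreducible closed subset of `A`. -/
theorem exists_irreducibleCloseds_image_eq [NoetherianSpace X] {f : X → Y} (hc : Continuous f)
    (hf : IsClosedMap f) {A : Set X} (hA : IsClosed A) {T : Set Y} (hT : IsIrreducible T)
    (hTc : IsClosed T) (hTA : T ⊆ f '' A) :
    ∃ Z : IrreducibleCloseds X, (Z : Set X) ⊆ A ∧ f '' Z = T := by
  -- Noetherianity splits `A ∩ f⁻¹(T)` into finitely many irreducible closed pieces; their images
  -- are closed and cover `T`, so one of them is all of `T`.
  obtain ⟨S, hSf, hSc, hSi, hSU⟩ :=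
    NoetherianSpace.exists_finite_set_isClosed_irreducible (hA.inter (hTc.preimage hc))
  classical
  obtain ⟨_, hz, hTz⟩ := isIrreducible_iff_sUnion_isClosed.1 hT (hSf.toFinset.image (f '' ·))
    (by simpa using fun z hz => hf z (hSc z hz)) (by
      intro y hy
      obtain ⟨x, hx, rfl⟩ := hTA hy
      have : x ∈ ⋃₀ S := hSU ▸ ⟨hx, hy⟩
      obtain ⟨z, hz, hxz⟩ := this
      exact ⟨f '' z, by simpa using ⟨z, hz, rfl⟩, x, hxz, rfl⟩)
  simp only [Finset.mem_image, Set.Finite.mem_toFinset] at hz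
  obtain ⟨z, hzS, rfl⟩ := hz
  have hzA : z ⊆ A ∩ f ⁻¹' T := hSU ▸ Set.subset_sUnion_of_mem hzS
  exact ⟨⟨z, hSi z hzS, hSc z hzS⟩, fun x hx => (hzA hx).1,
    (Set.image_subset_iff.2 fun x hx => (hzA hx).2).antisymm hTz⟩

/-- Chains lift from the top down: inside a lift of the largest member there is a lift of the next
one. Strictness is automatic because the images differ. -/
theorem exists_ltSeries_image_last_eq [NoetherianSpace X] {f : X → Y} (hc : Continuous f)
    (hf : IsClosedMap f) (s : LTSeries (IrreducibleCloseds Y)) :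
    ∀ Z : IrreducibleCloseds X, f '' (Z : Set X) = s.last →
      ∃ t : LTSeries (IrreducibleCloseds X), t.length = s.length ∧ t.last = Z := by
  induction s using RelSeries.inductionOn' with
  | singleton T => exact fun Z _ => ⟨RelSeries.singleton _ Z, rfl, rfl⟩
  | snoc s T hT ih =>
    intro Z hZ
    rw [RelSeries.last_snoc] at hZ
    have hlt : s.last < T := hT
    obtain ⟨Z', hZ', hfZ'⟩ := exists_irreducibleCloseds_image_eq hc hf Z.isClosed
      s.last.isIrreducible s.last.isClosed (hZ ▸ hlt.le)
    obtain ⟨t, ht, rfl⟩ := ih Z' hfZ'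
    have h : t.last < Z := lt_of_le_of_ne hZ' (by
      rintro rfl
      exact hlt.ne (SetLike.coe_injective (hfZ'.symm.trans hZ)))
    exact ⟨t.snoc Z h, by simp [ht], by simp⟩

theorem topologicalKrullDim_le_of_isClosedMap [NoetherianSpace X] {f : X → Y}
    (hc : Continuous f) (hf : IsClosedMap f) (hs : Function.Surjective f) :
    topologicalKrullDim Y ≤ topologicalKrullDim X := by
  refine iSup_le fun s => ?_
  obtain ⟨Z, -, hZ⟩ := exists_irreducibleCloseds_image_eq hc hf isClosed_univ
    s.last.isIrreducible s.last.isClosed (by simp [hs.range_eq])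
  obtain ⟨t, ht, -⟩ := exists_ltSeries_image_last_eq hc hf s Z hZ
  rw [← ht]
  exact le_iSup (fun s : LTSeries _ => (s.length : WithBot ℕ∞)) t

/-- Images of irreducible closed sets are irreducible and closed; incomparability keeps strict
inclusions strict. -/
theorem topologicalKrullDim_le_of_incomparable {f : X → Y} (hc : Continuous f)
    (hf : IsClosedMap f)
    (hinc : ∀ Z₁ Z₂ : Set X, IsClosed Z₁ → IsIrreducible Z₂ → Z₁ ⊆ Z₂ → f '' Z₂ ⊆ f '' Z₁ →
      Z₂ ⊆ Z₁) :
    topologicalKrullDim X ≤ topologicalKrullDim Y := by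
  refine Order.krullDim_le_of_strictMono (fun Z : IrreducibleCloseds X =>
    (⟨f '' Z, Z.isIrreducible.image f hc.continuousOn, hf _ Z.isClosed⟩ :
      IrreducibleCloseds Y)) fun Z₁ Z₂ h => ?_
  refine lt_of_le_not_ge (Set.image_mono h.le) fun h' => h.not_ge ?_
  exact hinc Z₁ Z₂ Z₁.isClosed Z₂.isIrreducible h.le h'

variable {G : Type*} [Group G] [Finite G] [MulAction G X] {π : X → Y}

theorem isClosedMap_of_finite_group (hG : ∀ g : G, Continuous fun x : X => g • x)
    (hπ : IsQuotientMap π) (hfib : ∀ x y, π x = π y ↔ ∃ g : G, g • x = y) : IsClosedMap π := by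
  intro Z hZ
  rw [← hπ.isClosed_preimage]
  have : π ⁻¹' (π '' Z) = ⋃ g : G, (fun x => g • x) ⁻¹' Z := by
    ext x
    simp only [Set.mem_preimage, Set.mem_image, Set.mem_iUnion]
    constructor
    · rintro ⟨z, hz, h⟩
      obtain ⟨g, rfl⟩ := (hfib x z).1 h.symm
      exact ⟨g, hz⟩
    · rintro ⟨g, hg⟩
      exact ⟨_, hg, ((hfib x _).2 ⟨g, rfl⟩).symm⟩
  rw [this]
  exact isClosed_iUnion_of_finite fun g => hZ.preimage (hG g)

omit [TopologicalSpace Y] in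
-- Finitely many translates of `Z₁` cover the irreducible `Z₂`, so `g Z₂ ⊆ Z₁ ⊆ Z₂` for a single
-- `g`. Iterating up to the order of `g` yields `Z₂ ⊆ Z₁`.
theorem subset_of_image_subset_of_finite_group (hG : ∀ g : G, Continuous fun x : X => g • x)
    (hfib : ∀ x y, π x = π y → ∃ g : G, g • x = y) {Z₁ Z₂ : Set X} (h₁ : IsClosed Z₁)
    (h₂ : IsIrreducible Z₂) (hsub : Z₁ ⊆ Z₂) (himg : π '' Z₂ ⊆ π '' Z₁) : Z₂ ⊆ Z₁ := by
  classical
  have := Fintype.ofFinite G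
  obtain ⟨_, hz, hle⟩ := isIrreducible_iff_sUnion_isClosed.1 h₂
    (Finset.univ.image fun g : G => (fun x => g • x) ⁻¹' Z₁)
    (by simpa using fun g => h₁.preimage (hG g)) (by
      intro x hx
      obtain ⟨z, hz, h⟩ := himg ⟨x, hx, rfl⟩
      obtain ⟨g, rfl⟩ := hfib x z h.symm
      exact ⟨_, by simpa using ⟨g, rfl⟩, hz⟩)
  simp only [Finset.mem_image, Finset.mem_univ, true_and] at hz
  obtain ⟨g, rfl⟩ := hz
  have hpow : ∀ i : ℕ, ∀ x ∈ Z₂, g ^ (i + 1) • x ∈ Z₁ := by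
    intro i
    induction i with
    | zero => intro x hx; simpa using hle hx
    | succ i ih =>
      intro x hx
      rw [pow_succ', mul_smul]
      exact hle (hsub (ih x hx))
  intro x hx
  have := hpow (orderOf g - 1) x hx
  rwa [Nat.sub_add_cancel (orderOf_pos g), pow_orderOf_eq_one, one_smul] at this

end Dimension

end PolyClass

namespace PolyClass

/-! ### Bireducibility of finite sets is affine equivalence -/

open Polynomial in
/-- A polynomial map under which a finite set with at least two elements is its own preimage
is linear. -/
theorem natDegree_eq_one_of_preimage_eq {k : Type*} [Field k] [IsAlgClosed k] [CharZero k]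
    {B : Set k} (hB : B.Finite) (h2 : 2 ≤ B.ncard) {R : k[X]}
    (hR : (fun x => R.eval x) ⁻¹' B = B) : R.natDegree = 1 := by
  classical
  have h0 : R.natDegree ≠ 0 := by
    intro h
    rw [eq_C_of_natDegree_eq_zero h] at hR
    by_cases hc : R.coeff 0 ∈ B
    · have : B = Set.univ := by rw [← hR]; ext; simpa using hc
      exact Set.infinite_univ (this ▸ hB)
    · have : B = ∅ := by rw [← hR]; ext; simpa using hc
      simp [this] at h2
  have hmem : ∀ x, R.eval x ∈ B ↔ x ∈ B := fun x => by
    conv_rhs => rw [← hR]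
    rfl
  rw [Set.ncard_eq_toFinset_card B hB] at h2
  have hne : ∀ c, R - C c ≠ 0 := fun c h => h0 (by rw [← natDegree_sub_C (a := c), h]; simp)
  have hcard : ∀ c ∈ hB.toFinset,
      ∑ x ∈ hB.toFinset, (R - C c).roots.count x = R.natDegree := by
    intro c hc
    rw [Multiset.sum_count_eq_card, ← (IsAlgClosed.splits _).natDegree_eq_card_roots,
      natDegree_sub_C]
    intro x hx
    rw [mem_roots (hne c), IsRoot, eval_sub, eval_C, sub_eq_zero] at hx
    rw [Set.Finite.mem_toFinset] at hc ⊢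
    rwa [← hmem, hx]
  -- Only `c = R x` contributes, and in characteristic zero a root of multiplicity `e` is a root of
  -- the derivative of multiplicity `e - 1`.
  have hmult : ∀ x ∈ hB.toFinset, ∑ c ∈ hB.toFinset, (R - C c).roots.count x ≤
      R.derivative.roots.count x + 1 := by
    intro x hx
    have hx' : R.eval x ∈ hB.toFinset := by simpa [hmem] using hx
    rw [Finset.sum_eq_single_of_mem _ hx' fun c _ hc => ?_]
    · have hroot : (R - C (R.eval x)).IsRoot x := by simp
      have := derivative_rootMultiplicity_of_root hroot
      rw [derivative_sub, derivative_C, sub_zero] at this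
      rw [count_roots, count_roots]
      omega
    · rw [Multiset.count_eq_zero, mem_roots (hne c), IsRoot, eval_sub, eval_C, sub_eq_zero]
      exact hc.symm
  have hder : ∑ x ∈ hB.toFinset, R.derivative.roots.count x ≤ R.natDegree - 1 := by
    refine le_trans ?_ (natDegree_derivative_le R)
    refine le_trans ?_ (card_roots' _)
    rw [← Multiset.sum_count_eq_card (s := hB.toFinset ∪ R.derivative.roots.toFinset)
      (m := R.derivative.roots) (by simp +contextual)]
    exact Finset.sum_le_sum_of_subset Finset.subset_union_left
  -- Double counting: with degree `d + 1` this gives `(d + 1) * |B| ≤ d + |B|`, which forces `d = 0`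
  -- as `|B| ≥ 2`.
  have h1 := Finset.sum_le_sum hmult
  rw [Finset.sum_comm, Finset.sum_congr rfl hcard, Finset.sum_add_distrib] at h1
  simp only [Finset.sum_const, smul_eq_mul, mul_one] at h1
  obtain ⟨d, hd⟩ := Nat.exists_eq_succ_of_ne_zero h0
  rw [hd] at h1 hder ⊢
  simp only [Nat.succ_sub_one] at hder
  have : d = 0 := by
    by_contra hd0
    have : 1 ≤ d := Nat.one_le_iff_ne_zero.2 hd0
    nlinarith
  simp [this]

theorem affine_image_eq_preimage {k : Type*} [Field k] {s t : k} (hs : s ≠ 0) (B : Set k) :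
    (fun x => s * x + t) '' B = (fun x => s⁻¹ * x + -(s⁻¹ * t)) ⁻¹' B := by
  refine congrFun (Set.image_eq_preimage_of_inverse (fun x => ?_) fun x => ?_) B <;>
    field_simp <;> ring

theorem polyEquiv_iff {k : Type*} [Field k] [IsAlgClosed k] [CharZero k] {A B : Set k}
    (hB : B.Finite) (h2 : 2 ≤ B.ncard) :
    PolyEquiv A B ↔ ∃ s t : k, s ≠ 0 ∧ A = (fun x => s * x + t) '' B := by
  constructor
  · rintro ⟨⟨P, rfl⟩, Q, hQ⟩
    have h1 : (P.comp Q).natDegree = 1 :=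
      natDegree_eq_one_of_preimage_eq hB h2 (by ext x; conv_rhs => rw [hQ]
                                                simp)
    rw [Polynomial.natDegree_comp] at h1
    obtain ⟨s, hs, t, rfl⟩ := Polynomial.natDegree_eq_one.1 (Nat.eq_one_of_mul_eq_one_right h1)
    refine ⟨s⁻¹, -(s⁻¹ * t), inv_ne_zero hs, ?_⟩
    rw [affine_image_eq_preimage (inv_ne_zero hs)]
    ext x
    simp [hs]
  · rintro ⟨s, t, hs, rfl⟩
    refine ⟨⟨.C s⁻¹ * .X + .C (-(s⁻¹ * t)), ?_⟩, ⟨.C s * .X + .C t, ?_⟩⟩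
    · rw [affine_image_eq_preimage hs]
      ext x
      simp
    · ext x
      simp only [Polynomial.eval_add, Polynomial.eval_mul, Polynomial.eval_C, Polynomial.eval_X,
        Set.mem_preimage, Set.mem_image, add_left_inj]
      exact ⟨fun h => ⟨x, h, rfl⟩, fun ⟨y, hy, h⟩ => mul_left_cancel₀ hs h ▸ hy⟩

/-! ### The variety `𝒫_n` as a quotient of `D(f_n)` by the symmetric group -/

section Regular

open MvPolynomial Topology

variable {k : Type*} [Field k] {n : ℕ}

/-- The algebra of regular functions on `D(f_n)`. -/
noncomputable abbrev algD (k : Type*) [Field k] (n : ℕ) : Subalgebra k (D k n → k) :=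
  principalAlgebra Function.Injective (f k n)

theorem isAffineAlgebra_algD : IsAffineAlgebra (algD k n) :=
  isAffineAlgebra_principalAlgebra injective_iff_eval_f_ne_zero

theorem coe_algD : (algD k n : Set (D k n → k)) = regD k n :=
  Set.ext fun F => mem_principalAlgebra_iff injective_iff_eval_f_ne_zero F

theorem eval_f_affine (s t : k) (a : AffSpace k n) :
    eval (fun i => s * a i + t) (f k n) =
      s ^ (Finset.univ : Finset (Fin n)).offDiag.card * eval a (f k n) := by
  simp only [f, map_prod, map_sub, eval_X]
  rw [← Finset.prod_const, ← Finset.prod_mul_distrib]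
  exact Finset.prod_congr rfl fun p _ => by ring

theorem eval_f_perm (σ : Equiv.Perm (Fin n)) (a : AffSpace k n) :
    eval (fun i => a (σ i)) (f k n) = eval a (f k n) := by
  simp only [f, map_prod, map_sub, eval_X]
  refine Finset.prod_equiv (Equiv.prodCongr σ σ) (fun p => ?_) fun p _ => rfl
  simp [Finset.mem_offDiag]

theorem sub_inv_mem_algD {i j : Fin n} (hij : i ≠ j) :
    (fun a => (a.1 i - a.1 j)⁻¹) ∈ algD k n := by
  have hm : (i, j) ∈ (Finset.univ : Finset (Fin n)).offDiag := by simpa using hij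
  refine (mem_principalAlgebra_iff injective_iff_eval_f_ne_zero _).2
    ⟨∏ p ∈ (Finset.univ : Finset (Fin n)).offDiag.erase (i, j), (X p.1 - X p.2), 1, fun a => ?_⟩
  have ha := (injective_iff_eval_f_ne_zero a.1).1 a.2
  have h : eval a.1 (f k n) = (a.1 i - a.1 j) * eval a.1
      (∏ p ∈ (Finset.univ : Finset (Fin n)).offDiag.erase (i, j), (X p.1 - X p.2)) := by
    rw [f, ← Finset.mul_prod_erase _ _ hm]
    simp
  rw [h] at ha
  rw [pow_one, h, mul_comm, ← div_div, div_self (right_ne_zero_of_mul ha), one_div]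

/-- Criterion for regularity of a map to a principal open subset of affine space. -/
theorem comp_mem_of_coord {X : Type*} {O : Subalgebra k (X → k)} {p : AffSpace k n → Prop}
    {h : MvPolynomial (Fin n) k} (φ : X → {x // p x})
    (hφ : ∀ i, (fun x => (φ x).1 i) ∈ O) (hh : (fun x => (eval (φ x).1 h)⁻¹) ∈ O)
    {F : {x // p x} → k} (hF : F ∈ principalAlgebra p h) : (fun x => F (φ x)) ∈ O := by
  have : principalAlgebra p h ≤ descend φ O := by
    refine Algebra.adjoin_le ?_
    rintro _ (rfl | ⟨i, rfl⟩)
    exacts [hh, hφ i]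
  exact this hF

theorem IsAffineAlgebra.continuous {X Y : Type*} [TopologicalSpace X] [TopologicalSpace Y]
    {O : Subalgebra k (X → k)} {O' : Subalgebra k (Y → k)} (hX : IsAffineAlgebra O)
    (hY : IsAffineAlgebra O') {φ : X → Y} (hφ : ∀ F ∈ O', (fun x => F (φ x)) ∈ O) :
    Continuous φ := by
  refine continuous_iff_isClosed.2 fun Z hZ => ?_
  obtain ⟨S, hS, rfl⟩ := (hY.isClosed_iff Z).1 hZ
  refine (hX.isClosed_iff _).2 ⟨(fun F x => F (φ x)) '' S, ?_, by ext; simp⟩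
  rintro _ ⟨F, hF, rfl⟩
  exact hφ F (hS hF)

/-! ### The action of the symmetric group on `D(f_n)` -/

instance : MulAction (Equiv.Perm (Fin n)) (D k n) where
  smul σ a := ⟨fun i => a.1 (σ⁻¹ i), a.2.comp (Equiv.injective _)⟩
  one_smul _ := rfl
  mul_smul _ _ _ := rfl

omit [Field k] in
theorem perm_smul_apply (σ : Equiv.Perm (Fin n)) (a : D k n) (i : Fin n) :
    (σ • a).1 i = a.1 (σ⁻¹ i) := rfl

theorem perm_regular (σ : Equiv.Perm (Fin n)) (F : D k n → k) (hF : F ∈ algD k n) :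
    (fun a => F (σ • a)) ∈ algD k n := by
  refine comp_mem_of_coord (fun a => σ • a) (fun i => coord_mem_principalAlgebra (σ⁻¹ i)) ?_ hF
  have : (fun a : D k n => (eval (σ • a).1 (f k n))⁻¹) = fun a => (eval a.1 (f k n))⁻¹ :=
    funext fun a => congrArg _ (eval_f_perm σ⁻¹ a.1)
  rw [this]
  exact inv_mem_principalAlgebra

theorem continuous_perm (σ : Equiv.Perm (Fin n)) : Continuous fun a : D k n => σ • a :=
  isAffineAlgebra_algD.continuous isAffineAlgebra_algD (perm_regular σ)

omit [Field k] in
theorem θ_eq_iff (a b : D k n) : θ k n a = θ k n b ↔ ∃ σ : Equiv.Perm (Fin n), σ • a = b := by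
  constructor
  · intro h
    have h' : Set.range a.1 = Set.range b.1 := congrArg Subtype.val h
    let σ : Equiv.Perm (Fin n) := (Equiv.ofInjective _ b.2).trans
      ((Equiv.setCongr h'.symm).trans (Equiv.ofInjective _ a.2).symm)
    refine ⟨σ⁻¹, Subtype.ext (funext fun i => ?_)⟩
    rw [perm_smul_apply, inv_inv]
    simp [σ, Equiv.apply_ofInjective_symm]
  · rintro ⟨σ, rfl⟩
    refine Subtype.ext ?_
    exact ((σ⁻¹ : Equiv.Perm (Fin n)).surjective.range_comp a.1).symm

omit [Field k] in
theorem θ_surjective : Function.Surjective (θ k n) := by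
  intro A
  have hfin : A.1.Finite := Set.finite_of_encard_eq_coe A.2
  have hcard : A.1.ncard = n := by
    rw [Set.ncard, A.2]; rfl
  have := hfin.fintype
  have hc : Fintype.card A.1 = n := by
    rw [← Nat.card_eq_fintype_card, Nat.card_coe_set_eq, hcard]
  let e : Fin n ≃ A.1 := (Fintype.equivFinOfCardEq hc).symm
  refine ⟨⟨fun i => e i, Subtype.val_injective.comp e.injective⟩, Subtype.ext ?_⟩
  change Set.range (Subtype.val ∘ e) = A.1
  rw [e.surjective.range_comp, Subtype.range_coe]

theorem isQuotientMap_θ : IsQuotientMap (θ k n) := ⟨⟨rfl⟩, θ_surjective⟩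

theorem isQuotientMap_θ' : IsQuotientMap (θ' k n) := ⟨⟨rfl⟩, Quotient.mk_surjective⟩

theorem coe_descend_θ : (descend (θ k n) (algD k n) : Set (P k n → k)) = regP k n := by
  ext F
  rw [SetLike.mem_coe, mem_descend, ← SetLike.mem_coe, coe_algD]
  rfl

theorem isAffineVariety_P [IsAlgClosed k] : IsAffineVariety k (P k n) (regP k n) := by
  rw [← coe_descend_θ]
  exact (isAffineAlgebra_algD.descend perm_regular isQuotientMap_θ θ_eq_iff).isAffineVariety

end Regular

end PolyClass

namespace PolyClass

/-! ### Affine transformations, normalized tuples and `Σ_n` -/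

open MvPolynomial Topology TopologicalSpace

variable {k : Type*} [Field k] {n m : ℕ}

/-- The affine transformation `x ↦ s x + t` acting on `D(f_n)`. -/
def affD {s : k} (hs : s ≠ 0) (t : k) (a : D k n) : D k n :=
  ⟨fun i => s * a.1 i + t, fun _ _ h => a.2 (mul_left_cancel₀ hs (add_right_cancel h))⟩

theorem θ_affD {s : k} (hs : s ≠ 0) (t : k) (a : D k n) :
    (θ k n (affD hs t a)).1 = (fun x => s * x + t) '' (θ k n a).1 :=
  Set.range_comp (fun x => s * x + t) a.1

theorem perm_smul_affD (σ : Equiv.Perm (Fin n)) {s : k} (hs : s ≠ 0) (t : k) (a : D k n) :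
    σ • affD hs t a = affD hs t (σ • a) := rfl

omit [Field k] in
theorem finite_P (B : P k n) : B.1.Finite := Set.finite_of_encard_eq_coe B.2

omit [Field k] in
theorem ncard_P (B : P k n) : B.1.ncard = n := by
  rw [Set.ncard, B.2]; rfl

theorem θ'_eq_iff [IsAlgClosed k] [CharZero k] (hn : 2 ≤ n) (a b : D k n) :
    θ' k n (θ k n a) = θ' k n (θ k n b) ↔
      ∃ (s : k) (hs : s ≠ 0) (t : k) (σ : Equiv.Perm (Fin n)), a = σ • affD hs t b := by
  have h1 : θ' k n (θ k n a) = θ' k n (θ k n b) ↔ PolyEquiv (θ k n a).1 (θ k n b).1 :=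
    Quotient.eq (r := polySetoid k n)
  rw [h1, polyEquiv_iff (finite_P _) ((ncard_P (θ k n b)).symm ▸ hn)]
  constructor
  · rintro ⟨s, t, hs, h⟩
    rw [← θ_affD hs] at h
    obtain ⟨σ, hσ⟩ := (θ_eq_iff _ _).1 (Subtype.ext h.symm)
    exact ⟨s, hs, t, σ, hσ.symm⟩
  · rintro ⟨s, hs, t, σ, rfl⟩
    refine ⟨s, t, hs, ?_⟩
    rw [← θ_affD hs, (θ_eq_iff (affD hs t b) (σ • affD hs t b)).2 ⟨σ, rfl⟩]

/-! ### Normalized tuples -/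

/-- The tuple `(0, 1, c_1, …, c_m)`. -/
def normTuple (c : AffSpace k m) : AffSpace k (m + 2) := Fin.cons 0 (Fin.cons 1 c)

/-- The tuples `c` such that `(0, 1, c)` has pairwise distinct coordinates. -/
abbrev W (k : Type*) [Field k] (m : ℕ) : Type _ :=
  {c : AffSpace k m // Function.Injective (normTuple c)}

/-- The polynomial `f_{m+2}(0, 1, X_1, …, X_m)`. -/
noncomputable def fW (k : Type*) [Field k] (m : ℕ) : MvPolynomial (Fin m) k :=
  bind₁ (Fin.cons 0 (Fin.cons 1 X) : Fin (m + 2) → MvPolynomial (Fin m) k) (f k (m + 2))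

theorem eval_fW (c : AffSpace k m) : eval c (fW k m) = eval (normTuple c) (f k (m + 2)) := by
  have h : ∀ p, eval c (bind₁ (Fin.cons 0 (Fin.cons 1 X) :
      Fin (m + 2) → MvPolynomial (Fin m) k) p) = eval (normTuple c) p := fun p => by
    induction p using MvPolynomial.induction_on with
    | C a => simp
    | add p q hp hq => simp [hp, hq]
    | mul_X p i hp =>
      rw [map_mul, map_mul, hp, map_mul, bind₁_X_right, eval_X]
      congr 1
      refine Fin.cases ?_ (fun i => Fin.cases ?_ (fun i => ?_) i) i <;> simp [normTuple]
  exact h _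

theorem injective_normTuple_iff (c : AffSpace k m) :
    Function.Injective (normTuple c) ↔ eval c (fW k m) ≠ 0 := by
  rw [injective_iff_eval_f_ne_zero, eval_fW]

/-- The algebra of regular functions on `W`. -/
noncomputable abbrev algW (k : Type*) [Field k] (m : ℕ) : Subalgebra k (W k m → k) :=
  principalAlgebra (fun c => Function.Injective (normTuple c)) (fW k m)

theorem isAffineAlgebra_algW : IsAffineAlgebra (algW k m) :=
  isAffineAlgebra_principalAlgebra injective_normTuple_iff

/-- The inclusion of normalized tuples. -/
def inclW (c : W k m) : D k (m + 2) := ⟨normTuple c.1, c.2⟩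

theorem sub_ne_zero_of_D (a : D k (m + 2)) : a.1 1 - a.1 0 ≠ 0 :=
  sub_ne_zero.2 (a.2.ne (by simp))

theorem normTuple_normalize (a : D k (m + 2)) :
    normTuple (fun i : Fin m => (a.1 1 - a.1 0)⁻¹ * a.1 i.succ.succ +
      -((a.1 1 - a.1 0)⁻¹ * a.1 0)) =
    (affD (inv_ne_zero (sub_ne_zero_of_D a)) (-((a.1 1 - a.1 0)⁻¹ * a.1 0)) a).1 := by
  have := sub_ne_zero_of_D a
  funext i
  refine Fin.cases ?_ (fun i => Fin.cases ?_ (fun i => ?_) i) i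
  · simp [normTuple, affD]
  · have h : (Fin.succ 0 : Fin (m + 2)) = 1 := rfl
    simp only [affD, h]
    rw [← sub_eq_add_neg, ← mul_sub, inv_mul_cancel₀ this]
    rfl
  · simp [normTuple, affD]

/-- The normalization of a tuple by the affine transformation that makes its first two
coordinates `0` and `1`. -/
def normalize (a : D k (m + 2)) : W k m :=
  ⟨fun i => (a.1 1 - a.1 0)⁻¹ * a.1 i.succ.succ + -((a.1 1 - a.1 0)⁻¹ * a.1 0), by
    rw [normTuple_normalize]; exact (affD _ _ a).2⟩

theorem inclW_normalize (a : D k (m + 2)) : inclW (normalize a) =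
    affD (inv_ne_zero (sub_ne_zero_of_D a)) (-((a.1 1 - a.1 0)⁻¹ * a.1 0)) a :=
  Subtype.ext (normTuple_normalize a)

theorem normalize_inclW (c : W k m) : normalize (inclW c) = c := by
  refine Subtype.ext (funext fun i => ?_)
  have h1 : normTuple c.1 1 = 1 := rfl
  have h0 : normTuple c.1 0 = 0 := rfl
  have h2 : normTuple c.1 i.succ.succ = c.1 i := rfl
  simp [normalize, inclW, h1, h0, h2]

theorem normalize_affD {s : k} (hs : s ≠ 0) (t : k) (a : D k (m + 2)) :
    normalize (affD hs t a) = normalize a := by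
  refine Subtype.ext (funext fun i => ?_)
  have := sub_ne_zero_of_D a
  simp only [normalize, affD]
  have h : s * a.1 1 + t - (s * a.1 0 + t) = s * (a.1 1 - a.1 0) := by ring
  rw [h]
  field_simp
  ring

theorem inclW_regular (F : D k (m + 2) → k) (hF : F ∈ algD k (m + 2)) :
    (fun c => F (inclW c)) ∈ algW k m := by
  refine comp_mem_of_coord inclW (fun i => ?_) ?_ hF
  · refine Fin.cases ?_ (fun i => Fin.cases ?_ (fun i => ?_) i) i
    · exact zero_mem (algW k m)
    · exact one_mem (algW k m)
    · exact coord_mem_principalAlgebra i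
  · convert inv_mem_principalAlgebra (p := fun c => Function.Injective (normTuple c))
      (h := fW k m) using 2 with c
    rw [eval_fW]; rfl

theorem normalize_regular (F : W k m → k) (hF : F ∈ algW k m) :
    (fun a => F (normalize a)) ∈ algD k (m + 2) := by
  have hinv : (fun a => (a.1 1 - a.1 0)⁻¹) ∈ algD k (m + 2) := sub_inv_mem_algD (by simp)
  have hc : ∀ i : Fin (m + 2), (fun a => a.1 i) ∈ algD k (m + 2) := coord_mem_principalAlgebra
  refine comp_mem_of_coord normalize (fun i => ?_) ?_ hF
  · exact add_mem (mul_mem hinv (hc _)) (neg_mem (mul_mem hinv (hc _)))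
  -- Normalization scales by `(a 1 - a 0)⁻¹`, and `f` is homogeneous of degree the number of
  -- off-diagonal pairs and translation invariant. So `1 / f` of the normalized tuple is a power of
  -- `a 1 - a 0` times `1 / f(a)`.
  · convert mul_mem (pow_mem (sub_mem (hc 1) (hc 0))
      (Finset.univ : Finset (Fin (m + 2))).offDiag.card) (inv_mem_principalAlgebra) using 1
    funext a
    have h := congrArg (fun b : D k (m + 2) => eval b.1 (f k (m + 2))) (inclW_normalize a)
    simp only [affD, eval_f_affine] at h
    simp only [eval_fW, Pi.mul_apply, Pi.pow_apply, Pi.sub_apply]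
    rw [show normTuple (normalize a).1 = (inclW (normalize a)).1 from rfl, h, mul_inv, inv_pow,
      inv_inv]

theorem continuous_inclW : Continuous (inclW : W k m → _) :=
  isAffineAlgebra_algW.continuous isAffineAlgebra_algD inclW_regular

theorem continuous_normalize : Continuous (normalize : _ → W k m) :=
  isAffineAlgebra_algD.continuous isAffineAlgebra_algW normalize_regular

/-- Permutations commute with affine maps, so an intermediate normalization is harmless; this is the
associativity of the action on `W`. -/
theorem normalize_smul_inclW_normalize (σ : Equiv.Perm (Fin (m + 2))) (a : D k (m + 2)) :
    normalize (σ • inclW (normalize a)) = normalize (σ • a) := by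
  rw [inclW_normalize, perm_smul_affD, normalize_affD]

/-- The symmetric group acts on normalized tuples by permutation followed by normalization. -/
instance : MulAction (Equiv.Perm (Fin (m + 2))) (W k m) where
  smul σ c := normalize (σ • inclW c)
  one_smul c := (congrArg normalize (one_smul _ _)).trans (normalize_inclW c)
  mul_smul σ τ c := (congrArg normalize (mul_smul σ τ (inclW c))).trans
    (normalize_smul_inclW_normalize σ _).symm

theorem permW_regular (σ : Equiv.Perm (Fin (m + 2))) (F : W k m → k) (hF : F ∈ algW k m) :
    (fun c => F (σ • c)) ∈ algW k m :=
  inclW_regular _ (perm_regular σ _ (normalize_regular F hF))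

/-! ### The variety `Σ_n` as a quotient of the variety of normalized tuples -/

/-- The class of a normalized tuple. -/
def θW (k : Type*) [Field k] (m : ℕ) (c : W k m) : Sig k (m + 2) :=
  θ' k (m + 2) (θ k (m + 2) (inclW c))

theorem θ'_θ_smul (σ : Equiv.Perm (Fin n)) (a : D k n) :
    θ' k n (θ k n (σ • a)) = θ' k n (θ k n a) :=
  congrArg _ ((θ_eq_iff a (σ • a)).2 ⟨σ, rfl⟩).symm

variable [IsAlgClosed k] [CharZero k]

theorem θ'_θ_affD (hn : 2 ≤ n) {s : k} (hs : s ≠ 0) (t : k) (a : D k n) :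
    θ' k n (θ k n (affD hs t a)) = θ' k n (θ k n a) :=
  (θ'_eq_iff hn _ _).2 ⟨s, hs, t, 1, (one_smul _ _).symm⟩

theorem θW_normalize (a : D k (m + 2)) : θW k m (normalize a) = θ' k _ (θ k _ a) := by
  rw [θW, inclW_normalize, θ'_θ_affD (by omega)]

theorem θW_eq_iff (c d : W k m) :
    θW k m c = θW k m d ↔ ∃ σ : Equiv.Perm (Fin (m + 2)), σ • c = d := by
  constructor
  · intro h
    obtain ⟨s, hs, t, σ, hσ⟩ := (θ'_eq_iff (by omega) _ _).1 h.symm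
    refine ⟨σ, ?_⟩
    rw [perm_smul_affD] at hσ
    rw [← normalize_inclW d, hσ, normalize_affD]
    rfl
  · rintro ⟨σ, rfl⟩
    change _ = θW k m (normalize (σ • inclW c))
    rw [θW_normalize, θ'_θ_smul]
    rfl

/-- `θW ∘ normalize` is the quotient map `θ' ∘ θ`, so the topology that `Σ_n` gets from `𝒫_n` is
also the one coming from `W`. -/
theorem isQuotientMap_θW : IsQuotientMap (θW k m) := by
  refine IsQuotientMap.of_comp (f := normalize) continuous_normalize
    (isQuotientMap_θ'.continuous.comp (isQuotientMap_θ.continuous.comp continuous_inclW)) ?_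
  convert isQuotientMap_θ'.comp isQuotientMap_θ using 1
  funext a
  exact θW_normalize a

theorem coe_descend_θW :
    (descend (θW k m) (algW k m) : Set (Sig k (m + 2) → k)) = regSig k (m + 2) := by
  ext F
  change F ∘ θW k m ∈ algW k m ↔ (F ∘ θ' k _) ∘ θ k _ ∈ regD k _
  rw [← coe_algD, SetLike.mem_coe]
  constructor
  · intro h
    convert normalize_regular _ h using 1
    funext a
    exact congrArg F (θW_normalize a).symm
  · intro h
    exact inclW_regular _ h

theorem isAffineAlgebra_Sig : IsAffineAlgebra (descend (θW k m) (algW k m)) :=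
  isAffineAlgebra_algW.descend permW_regular isQuotientMap_θW θW_eq_iff

omit [IsAlgClosed k] [CharZero k] in
theorem isOpen_setOf_injective_normTuple :
    IsOpen {c : AffSpace k m | Function.Injective (normTuple c)} := by
  rw [← isClosed_compl_iff]
  convert isClosed_zero (fW k m) using 1
  ext c
  simp [injective_normTuple_iff]

omit [IsAlgClosed k] in
theorem nonempty_W : Nonempty (W k m) :=
  ⟨normalize ⟨fun i => (i : ℕ), fun _ _ h => Fin.ext (Nat.cast_injective h)⟩⟩

theorem topologicalKrullDim_W : topologicalKrullDim (W k m) = m := by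
  obtain ⟨c, hc⟩ := nonempty_W (k := k) (m := m)
  exact topologicalKrullDim_of_isOpen isOpen_setOf_injective_normTuple ⟨c, hc⟩

omit [CharZero k] in
theorem irreducibleSpace_of_isOpen {U : Set (AffSpace k m)} (hU : IsOpen U)
    (hne : U.Nonempty) : IrreducibleSpace U where
  toNonempty := hne.to_subtype
  isPreirreducible_univ :=
    (PreirreducibleSpace.isPreirreducible_univ (X := AffSpace k m)).preimage
      hU.isOpenEmbedding_subtypeVal

theorem irreducibleSpace_Sig : IrreducibleSpace (Sig k (m + 2)) := by
  obtain ⟨c, hc⟩ := nonempty_W (k := k) (m := m)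
  have : IrreducibleSpace (W k m) :=
    irreducibleSpace_of_isOpen isOpen_setOf_injective_normTuple ⟨c, hc⟩
  have h := (IrreducibleSpace.isIrreducible_univ (W k m)).image _
    isQuotientMap_θW.continuous.continuousOn
  rw [Set.image_univ, isQuotientMap_θW.surjective.range_eq] at h
  exact { toNonempty := ⟨θW k m ⟨c, hc⟩⟩, isPreirreducible_univ := h.2 }

theorem topologicalKrullDim_Sig : topologicalKrullDim (Sig k (m + 2)) = m := by
  have : NoetherianSpace (W k m) := IsInducing.subtypeVal.noetherianSpace
  have hact : ∀ σ : Equiv.Perm (Fin (m + 2)), Continuous fun c : W k m => σ • c := fun σ =>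
    isAffineAlgebra_algW.continuous isAffineAlgebra_algW (permW_regular σ)
  have hcl : IsClosedMap (θW k m) := isClosedMap_of_finite_group hact isQuotientMap_θW θW_eq_iff
  rw [← topologicalKrullDim_W (k := k)]
  refine le_antisymm (topologicalKrullDim_le_of_isClosedMap isQuotientMap_θW.continuous hcl
    isQuotientMap_θW.surjective) ?_
  exact topologicalKrullDim_le_of_incomparable isQuotientMap_θW.continuous hcl
    fun Z₁ Z₂ h₁ h₂ => subset_of_image_subset_of_finite_group hact
      (fun c d => (θW_eq_iff c d).1) h₁ h₂

/-! ### Polynomial classes -/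

theorem encard_of_mem_polyClass (hn : 2 ≤ n) (B : P k n) {A : Set k}
    (hA : A ∈ polyClass B.1) : A.encard = n := by
  obtain ⟨s, t, hs, rfl⟩ := (polyEquiv_iff (finite_P B) ((ncard_P B).symm ▸ hn)).1 hA
  rw [Function.Injective.encard_image, B.2]
  exact fun x y h => mul_left_cancel₀ hs (add_right_cancel h)

/-- A class is a fibre of `θ'`, and points of the affine variety `Σ_n` are closed. -/
theorem isClosed_classInP (B : P k (m + 2)) : IsClosed (classInP B) := by
  have : classInP B = θ' k (m + 2) ⁻¹' {θ' k (m + 2) B} := by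
    ext A
    exact (Quotient.eq (r := polySetoid k (m + 2))).symm
  rw [this]
  exact (isAffineAlgebra_Sig.isClosed_singleton _).preimage isQuotientMap_θ'.continuous

/-- The coefficients `(s, t)` of the affine transformations `x ↦ s x + t`. -/
abbrev AffGroup (k : Type*) [Field k] : Set (AffSpace k 2) := {u | u 0 ≠ 0}

omit [IsAlgClosed k] [CharZero k] in
theorem isOpen_affGroup : IsOpen (AffGroup k) := by
  rw [← isClosed_compl_iff]
  convert isClosed_zero (X 0 : MvPolynomial (Fin 2) k) using 1
  ext c
  simp

omit [IsAlgClosed k] [CharZero k] in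
/-- The orbit map of a tuple under the affine group is a closed embedding. -/
theorem isClosedEmbedding_affD (b : D k (m + 2)) :
    IsClosedEmbedding fun u : AffGroup k => affD u.2 (u.1 1) b := by
  have hb := sub_ne_zero_of_D b
  have hc : ∀ i : Fin (m + 2), (fun a => a.1 i) ∈ algD k (m + 2) := coord_mem_principalAlgebra
  have hk : ∀ c : k, (fun _ => c) ∈ algD k (m + 2) := fun c => Subalgebra.algebraMap_mem _ c
  -- `s` and `t` are the coefficients of the unique affine map sending the first two coordinates of
  -- `b` to those of `a`. They give a continuous retraction `ρ`, and the orbit is the closed set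
  -- where this map sends all of `b` to `a`.
  let s : D k (m + 2) → k := fun a => (a.1 1 - a.1 0) * (b.1 1 - b.1 0)⁻¹
  have hs : s ∈ algD k (m + 2) := mul_mem (sub_mem (hc 1) (hc 0)) (hk _)
  let t : D k (m + 2) → k := fun a => a.1 0 - s a * b.1 0
  have ht : t ∈ algD k (m + 2) := sub_mem (hc 0) (mul_mem hs (hk _))
  let ρ : D k (m + 2) → AffGroup k := fun a =>
    ⟨![s a, t a], mul_ne_zero (sub_ne_zero_of_D a) (inv_ne_zero hb)⟩
  have hρ : Continuous ρ := by
    refine Continuous.subtype_mk (continuous_of_regular (algD k (m + 2))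
      (fun F => isAffineAlgebra_algD.isClosed_zero) _ fun i => ?_) _
    fin_cases i
    exacts [hs, ht]
  have hcont : Continuous fun u : AffGroup k => affD u.2 (u.1 1) b := by
    refine Continuous.subtype_mk (f := fun u : AffGroup k => fun i => u.1 0 * b.1 i + u.1 1) ?_ _
    exact (continuous_of_eval (fun i => X 0 * C (b.1 i) + X 1)
      (fun u i => u 0 * b.1 i + u 1) (by simp)).comp continuous_subtype_val
  have hinv : Function.LeftInverse ρ fun u : AffGroup k => affD u.2 (u.1 1) b := by
    intro u
    have h0 : s (affD u.2 (u.1 1) b) = u.1 0 := by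
      simp only [s, affD]
      field_simp
      ring
    refine Subtype.ext (funext fun i => ?_)
    fin_cases i
    · exact h0
    · change t _ = u.1 1
      simp only [t, h0]
      simp [affD]
  refine ⟨hinv.isEmbedding hρ hcont, ?_⟩
  have : Set.range (fun u : AffGroup k => affD u.2 (u.1 1) b) =
      ⋂ i, {a | s a * b.1 i + t a - a.1 i = 0} := by
    ext a
    simp only [Set.mem_range, Set.mem_iInter, Set.mem_ofPred_eq, sub_eq_zero]
    constructor
    · rintro ⟨u, rfl⟩ i
      have h := hinv u
      exact congrFun (congrArg (fun v : AffGroup k => (affD v.2 (v.1 1) b).1) h) i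
    · exact fun h => ⟨ρ a, Subtype.ext (funext h)⟩
  rw [this]
  exact isClosed_iInter fun i => isAffineAlgebra_algD.isClosed_zero
    (sub_mem (add_mem (mul_mem hs (hk _)) ht) (hc i))

/-- The polynomial class of a set consists of its images under affine transformations. -/
theorem range_θ_affD (b : D k (m + 2)) :
    Set.range (fun u : AffGroup k => θ k (m + 2) (affD u.2 (u.1 1) b)) =
      classInP (θ k (m + 2) b) := by
  ext A
  have hA : A ∈ classInP (θ k (m + 2) b) ↔ _ :=
    polyEquiv_iff (finite_P _) ((ncard_P (θ k (m + 2) b)).symm ▸ (by omega : 2 ≤ m + 2))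
  rw [hA]
  constructor
  · rintro ⟨u, rfl⟩
    exact ⟨u.1 0, u.1 1, u.2, θ_affD _ _ _⟩
  · rintro ⟨s, t, hs, h⟩
    exact ⟨⟨![s, t], hs⟩, Subtype.ext ((θ_affD _ _ _).trans h.symm)⟩

omit [CharZero k] in
theorem irreducibleSpace_affGroup : IrreducibleSpace (AffGroup k) :=
  irreducibleSpace_of_isOpen isOpen_affGroup ⟨1, one_ne_zero⟩

theorem isIrreducible_classInP (B : P k (m + 2)) : IsIrreducible (classInP B) := by
  obtain ⟨b, rfl⟩ := θ_surjective B
  have := irreducibleSpace_affGroup (k := k)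
  rw [← range_θ_affD, ← Set.image_univ]
  exact (IrreducibleSpace.isIrreducible_univ _).image _
    (isQuotientMap_θ.continuous.comp (isClosedEmbedding_affD b).continuous).continuousOn

theorem topologicalKrullDim_classInP (B : P k (m + 2)) :
    topologicalKrullDim (classInP B) = 2 := by
  obtain ⟨b, rfl⟩ := θ_surjective B
  have hl := isClosedEmbedding_affD b
  have hmem : ∀ u : AffGroup k, θ k (m + 2) (affD u.2 (u.1 1) b) ∈ classInP (θ k (m + 2) b) :=
    fun u => range_θ_affD b ▸ ⟨u, rfl⟩
  let φ : AffGroup k → classInP (θ k (m + 2) b) := fun u => ⟨_, hmem u⟩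
  have hφ : Continuous φ := (isQuotientMap_θ.continuous.comp hl.continuous).subtype_mk _
  have hcl : IsClosedMap φ :=
    ((isClosedMap_of_finite_group continuous_perm isQuotientMap_θ θ_eq_iff).comp
      hl.isClosedMap).subtype_mk hmem
  have hsurj : Function.Surjective φ := by
    rintro ⟨A, hA⟩
    obtain ⟨u, rfl⟩ := (range_θ_affD b).symm ▸ hA
    exact ⟨u, rfl⟩
  have : NoetherianSpace (AffGroup k) := IsInducing.subtypeVal.noetherianSpace
  have hdim : topologicalKrullDim (AffGroup k) = 2 :=
    topologicalKrullDim_of_isOpen isOpen_affGroup ⟨1, one_ne_zero⟩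
  rw [← hdim]
  refine le_antisymm (topologicalKrullDim_le_of_isClosedMap hφ hcl hsurj)
    (topologicalKrullDim_le_of_incomparable hφ hcl fun Z₁ Z₂ h₁ h₂ hsub himg => ?_)
  -- `Sym_n` need not preserve the affine orbit of `b`, so incomparability is applied in `D(f_n)` to
  -- the images of `Z₁` and `Z₂`, and pulled back by injectivity of the orbit map.
  have key := subset_of_image_subset_of_finite_group continuous_perm
    (fun a b => (θ_eq_iff a b).1) (hl.isClosedMap _ h₁) (h₂.image _ hl.continuous.continuousOn)
    (Set.image_mono hsub) (by
      rintro _ ⟨_, ⟨u, hu, rfl⟩, rfl⟩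
      obtain ⟨v, hv, h⟩ := himg ⟨u, hu, rfl⟩
      exact ⟨_, ⟨v, hv, rfl⟩, congrArg Subtype.val h⟩)
  exact (Set.image_subset_image_iff hl.injective).1 key

end PolyClass

theorem mainTheorem2 (k : Type*) [Field k] [IsAlgClosed k] [CharZero k] (n : ℕ) (hn : 2 ≤ n) :
    -- `𝒫_n` is an affine variety
    PolyClass.IsAffineVariety k (PolyClass.P k n) (PolyClass.regP k n) ∧
    -- every polynomial class of an `n`-element set is a `2`-dimensional subvariety of `𝒫_n`
    (∀ B : PolyClass.P k n,
      (∀ A ∈ PolyClass.polyClass B.1, A.encard = n) ∧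
      IsClosed (PolyClass.classInP B) ∧
      IsIrreducible (PolyClass.classInP B) ∧
      topologicalKrullDim (PolyClass.classInP B) = 2) ∧
    -- `Σ_n` is an irreducible affine variety of dimension `n - 2`
    PolyClass.IsAffineVariety k (PolyClass.Sig k n) (PolyClass.regSig k n) ∧
    IrreducibleSpace (PolyClass.Sig k n) ∧
    topologicalKrullDim (PolyClass.Sig k n) = ((n - 2 : ℕ) : WithBot ℕ∞) := by
  obtain ⟨m, rfl⟩ := Nat.exists_eq_add_of_le' hn
  refine ⟨PolyClass.isAffineVariety_P, fun B => ⟨fun A => PolyClass.encard_of_mem_polyClass hn B,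
    PolyClass.isClosed_classInP B, PolyClass.isIrreducible_classInP B,
    PolyClass.topologicalKrullDim_classInP B⟩, ?_, PolyClass.irreducibleSpace_Sig,
    PolyClass.topologicalKrullDim_Sig⟩
  rw [← PolyClass.coe_descend_θW]
  exact PolyClass.isAffineAlgebra_Sig.isAffineVariety
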